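/- Let $\Omega\subset\mathbb{R}^2$ be open and connected, and let $f,g:\Omega\to\mathbb{R}$ be real-analytic, with $f$ not constant. For $x\in\Omega$ let $d_f(x)$ be the first integer $k\ge 1$ for which the $k$-th derivative $D^kf(x)$ is not zero; a point $x\in\Omega$ is called a critical point of $f$ of even order if $d_f(x)$ is even. Assume that $$\{f,g\}:=\nabla^{\perp}f\cdot\nabla g=\partial_1 f\,\partial_2 g-\partial_2 f\,\partial_1 g=0\quad\text{on }\Omega$$ and that the critical points of $f$ of even order are isolated, that is, each of them has a neighborhood containing no other critical point of $f$ of even order. Then there exists a function $F$, defined and continuous on the range $f(\Omega)\subset\mathbb{R}$ of $f$, such that $$g(x)=F(f(x))\quad\text{for all }x\in\Omega.$$ -/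

import Mathlib

open Topology Filter

/-- The Euclidean plane. -/
abbrev Plane : Type := EuclideanSpace ℝ (Fin 2)

/-- The partial derivative `∂ᵢ f` at `x`. -/
noncomputable def partialDeriv (i : Fin 2) (f : Plane → ℝ) (x : Plane) : ℝ :=
  fderiv ℝ f x (EuclideanSpace.single i 1)

/-- The Poisson bracket `{f, g} = ∇^⊥ f · ∇ g`, where `∇^⊥ = (-∂₂, ∂₁)`. -/
noncomputable def poissonBracket (f g : Plane → ℝ) (x : Plane) : ℝ :=
  -(partialDeriv 1 f x) * partialDeriv 0 g x + partialDeriv 0 f x * partialDeriv 1 g x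

/-- The degree `d_f(x)`: the first `k ≥ 1` for which the `k`-th derivative `D^k f (x)` is not zero.
(It is `0` if there is no such `k`, which does not happen for an analytic function that is not
constant on a connected open set containing `x`.) -/
noncomputable def vanishingDegree (f : Plane → ℝ) (x : Plane) : ℕ :=
  sInf {k : ℕ | 1 ≤ k ∧ iteratedFDeriv ℝ k f x ≠ 0}

/-- The critical points of `f` in `Ω` of even order. -/
def evenCriticalPoints (Ω : Set Plane) (f : Plane → ℝ) : Set Plane :=
  {x ∈ Ω | 1 < vanishingDegree f x ∧ Even (vanishingDegree f x)}

/-! The even critical points form a countable set, so removing them leaves a connected dense set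
`X`. At `x ∈ X` the degree `d` is odd, and along a suitable line `f - f x` vanishes to order exactly
`d`; reparametrizing gives an analytic curve `c` with `f (c s) = f x + s ^ d`. Hence `f` is open at
`x`, and `F τ = g (c (oddRoot d (τ - f x)))` is the candidate local factor. It is correct near `c
s`, `s ≠ 0`, where `∇f ≠ 0`, and this spreads along segments by an identity theorem for analytic
functions of odd roots (`OddPuiseuxAt`). See `exists_local_factorization`.

Openness makes the germ of `F` at `f x` unique, so local factors continue along the connected `X`.
The continuation lives on intervals, whose intersections are connected, so there is no monodromy
(`exists_factorization_on`). The result is continuous on an open interval `J`; values of `f` outside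
`J` are endpoints, reached by taking limits (`exists_continuousOn_factorization`). -/

/-- The real `d`-th root, meaningful for odd `d`. -/
noncomputable def oddRoot (d : ℕ) (y : ℝ) : ℝ := SignType.sign y * |y| ^ ((d : ℝ)⁻¹)

/-! ### Odd roots of real numbers and of analytic functions -/

section OddRoot

variable {d : ℕ}

theorem oddRoot_pow (hd : Odd d) (y : ℝ) : oddRoot d y ^ d = y := by
  have h : (|y| ^ ((d : ℝ)⁻¹)) ^ d = |y| := Real.rpow_inv_natCast_pow (abs_nonneg y) hd.pos.ne'
  rw [oddRoot, mul_pow, h]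
  rcases lt_trichotomy y 0 with hy | rfl | hy
  · simp [sign_neg hy, abs_of_neg hy, hd.neg_one_pow]
  · simp
  · simp [sign_pos hy, abs_of_pos hy]

theorem oddRoot_pow_self (hd : Odd d) (w : ℝ) : oddRoot d (w ^ d) = w :=
  hd.strictMono_pow.injective (oddRoot_pow hd _)

theorem oddRoot_zero (hd : Odd d) : oddRoot d 0 = 0 := by
  simpa [hd.pos.ne'] using oddRoot_pow_self hd 0

theorem oddRoot_mul (hd : Odd d) (a b : ℝ) : oddRoot d (a * b) = oddRoot d a * oddRoot d b :=
  hd.strictMono_pow.injective (by simp only [mul_pow, oddRoot_pow hd])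

theorem oddRoot_ne_zero (hd : Odd d) {y : ℝ} (hy : y ≠ 0) : oddRoot d y ≠ 0 := fun h => by
  have := oddRoot_pow hd y
  rw [h, zero_pow hd.pos.ne'] at this
  exact hy this.symm

theorem continuous_oddRoot (hd : Odd d) : Continuous (oddRoot d) := by
  refine Monotone.continuous_of_surjective (fun a b hab => ?_)
    fun w => ⟨w ^ d, oddRoot_pow_self hd w⟩
  rw [← hd.strictMono_pow.le_iff_le]
  simpa only [oddRoot_pow hd] using hab

theorem analyticAt_oddRoot {y : ℝ} (hy : y ≠ 0) : AnalyticAt ℝ (oddRoot d) y := by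
  rcases lt_or_gt_of_ne hy with hy | hy
  · have h : AnalyticAt ℝ (fun z : ℝ => -((-z) ^ ((d : ℝ)⁻¹))) y :=
      (AnalyticAt.fun_comp (g := fun z : ℝ => z ^ ((d : ℝ)⁻¹)) (f := fun z : ℝ => -z)
        (Real.contDiffAt_rpow_const_of_ne (n := ⊤) (by simpa using hy.ne)).analyticAt
        (by fun_prop)).neg
    refine h.congr ?_
    filter_upwards [eventually_lt_nhds hy] with z hz
    simp [oddRoot, sign_neg hz, abs_of_neg hz]
  · have h : AnalyticAt ℝ (fun z : ℝ => z ^ ((d : ℝ)⁻¹)) y :=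
      (Real.contDiffAt_rpow_const_of_ne (n := ⊤) hy.ne').analyticAt
    refine h.congr ?_
    filter_upwards [eventually_gt_nhds hy] with z hz
    simp [oddRoot, sign_pos hz, abs_of_pos hz]

/-- If `ψ z = z ^ m * u z` with `u 0 ≠ 0`, then `ψ (w ^ d)` carries the factor `(w ^ m) ^ d`, whose
root is `w ^ m`, and the root of the unit `u` is analytic. -/
theorem analyticAt_oddRoot_comp_pow (hd : Odd d) {ψ : ℝ → ℝ} (hψ : AnalyticAt ℝ ψ 0) :
    AnalyticAt ℝ (fun w => oddRoot d (ψ (w ^ d))) 0 := by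
  have ht : Tendsto (fun w : ℝ => w ^ d) (𝓝 0) (𝓝 0) := by
    simpa [hd.pos.ne'] using (continuous_pow (M := ℝ) d).tendsto 0
  by_cases h0 : ∀ᶠ z in 𝓝 0, ψ z = 0
  · refine (analyticAt_const (v := (0 : ℝ))).congr ?_
    filter_upwards [ht.eventually h0] with w hw
    rw [hw, oddRoot_zero hd]
  · obtain ⟨m, u, hu, hu0, hψu⟩ := hψ.exists_eventuallyEq_pow_smul_nonzero_iff.2 h0
    have hp : AnalyticAt ℝ (fun w : ℝ => w ^ d) 0 := analyticAt_id.pow d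
    have h1 : AnalyticAt ℝ (fun w : ℝ => w ^ m * oddRoot d (u (w ^ d))) 0 := by
      refine (analyticAt_id.pow m).mul ?_
      refine AnalyticAt.fun_comp (f := fun w : ℝ => u (w ^ d)) (g := oddRoot d) ?_ ?_
      · exact analyticAt_oddRoot (by simpa [hd.pos.ne'] using hu0)
      · exact AnalyticAt.fun_comp (by simpa [hd.pos.ne'] using hu) hp
    refine h1.congr ?_
    filter_upwards [ht.eventually hψu] with w hw
    rw [hw, sub_zero, smul_eq_mul, oddRoot_mul hd, ← pow_mul, mul_comm d m, pow_mul,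
      oddRoot_pow_self hd]

/-- For odd `d` the substitution has a continuous inverse, so statements near `a` transfer to the
variable `w` near `0` on both sides. -/
theorem map_pow_nhds_zero (hd : Odd d) (a : ℝ) : map (fun w : ℝ => a + w ^ d) (𝓝 0) = 𝓝 a := by
  have h1 : Tendsto (fun w : ℝ => a + w ^ d) (𝓝 0) (𝓝 a) := by
    have : Continuous fun w : ℝ => a + w ^ d := by fun_prop
    simpa [hd.pos.ne'] using this.tendsto 0
  refine le_antisymm h1 ?_
  have h2 : Tendsto (fun z : ℝ => oddRoot d (z - a)) (𝓝 a) (𝓝 0) := by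
    have : Continuous fun z : ℝ => oddRoot d (z - a) :=
      (continuous_oddRoot hd).comp (continuous_id.sub continuous_const)
    simpa [oddRoot_zero hd] using this.tendsto a
  have := map_mono (m := fun w : ℝ => a + w ^ d) h2
  rw [map_map] at this
  convert this using 1
  have : (fun w : ℝ => a + w ^ d) ∘ (fun z : ℝ => oddRoot d (z - a)) = id := by
    ext z; simp [oddRoot_pow hd]
  rw [this, map_id]

end OddRoot

/-! ### Analytic functions of odd roots and their identity theorem -/

/-- `h` is near `a` an analytic function of an odd root of the variable centred at `a`. -/
def OddPuiseuxAt (h : ℝ → ℝ) (a : ℝ) : Prop :=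
  ∃ d : ℕ, Odd d ∧ AnalyticAt ℝ (fun w => h (a + w ^ d)) 0

theorem AnalyticAt.oddPuiseuxAt {h : ℝ → ℝ} {a : ℝ} (hh : AnalyticAt ℝ h a) :
    OddPuiseuxAt h a :=
  ⟨1, odd_one, AnalyticAt.fun_comp (by simpa using hh) (by fun_prop)⟩

namespace OddPuiseuxAt

variable {h k : ℝ → ℝ} {a : ℝ}

theorem analyticAt_pow_mul {d e : ℕ} (he : Odd e)
    (hh : AnalyticAt ℝ (fun w => h (a + w ^ d)) 0) :
    AnalyticAt ℝ (fun w => h (a + w ^ (e * d))) 0 := by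
  simp only [pow_mul]
  exact AnalyticAt.fun_comp (g := fun w => h (a + w ^ d)) (f := fun w : ℝ => w ^ e)
    (by simpa [he.pos.ne'] using hh) (by fun_prop)

theorem continuousAt (hh : OddPuiseuxAt h a) : ContinuousAt h a := by
  obtain ⟨d, hd, hh⟩ := hh
  have := hh.continuousAt
  rw [ContinuousAt, ← map_pow_nhds_zero hd a, tendsto_map'_iff]
  simpa [ContinuousAt, hd.pos.ne', Function.comp_def] using this

theorem congr (hh : OddPuiseuxAt h a) (hk : h =ᶠ[𝓝 a] k) : OddPuiseuxAt k a := by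
  obtain ⟨d, hd, hh⟩ := hh
  refine ⟨d, hd, hh.congr ?_⟩
  rw [← map_pow_nhds_zero hd a] at hk
  exact hk

theorem comp_analyticAt {F φ : ℝ → ℝ} (hF : OddPuiseuxAt F (φ a)) (hφ : AnalyticAt ℝ φ a) :
    OddPuiseuxAt (fun t => F (φ t)) a := by
  obtain ⟨d, hd, hF⟩ := hF
  refine ⟨d, hd, ?_⟩
  have h1 : AnalyticAt ℝ (fun t => φ (a + t) - φ a) 0 := by
    refine AnalyticAt.sub ?_ analyticAt_const
    exact AnalyticAt.fun_comp (by simpa using hφ) (by fun_prop)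
  have h2 := analyticAt_oddRoot_comp_pow hd h1
  have h3 := AnalyticAt.fun_comp (g := fun w => F (φ a + w ^ d))
    (f := fun w => oddRoot d (φ (a + w ^ d) - φ a)) (x := 0)
    (by simpa [hd.pos.ne', oddRoot_zero hd] using hF) h2
  simpa [oddRoot_pow hd] using h3

/-- Raising to the common exponent `e * d` makes both functions analytic in the same variable, where
the usual identity theorem applies. -/
theorem eventuallyEq_of_frequently (hh : OddPuiseuxAt h a) (hk : OddPuiseuxAt k a)
    (hfr : ∃ᶠ t in 𝓝[≠] a, h t = k t) : h =ᶠ[𝓝 a] k := by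
  obtain ⟨d, hd, hh⟩ := hh
  obtain ⟨e, he, hk⟩ := hk
  have hh' := analyticAt_pow_mul he hh
  have hk' := analyticAt_pow_mul hd hk
  rw [mul_comm] at hk'
  have hed := he.mul hd
  have hev := (hh'.frequently_eq_iff_eventually_eq hk').1 ?_
  · rw [EventuallyEq, ← map_pow_nhds_zero hed a]
    exact hev
  · rw [frequently_nhdsWithin_iff, ← map_pow_nhds_zero hed a, frequently_map] at hfr
    rw [frequently_nhdsWithin_iff]
    refine hfr.mono fun w hw => ⟨hw.1, fun h0 => hw.2 ?_⟩
    simp only [Set.mem_singleton_iff] at h0 ⊢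
    simp [h0, hed.pos.ne']

/-- Away from `a` the root is itself analytic, so `h` is analytic at nearby points other than `a`.
-/
theorem eventually (hh : OddPuiseuxAt h a) : ∀ᶠ b in 𝓝 a, OddPuiseuxAt h b := by
  have hh0 := hh
  obtain ⟨d, hd, hh⟩ := hh
  have h1 : ∀ᶠ w in 𝓝 (0 : ℝ), AnalyticAt ℝ (fun w => h (a + w ^ d)) w :=
    hh.eventually_analyticAt
  have h2 : Tendsto (fun z : ℝ => oddRoot d (z - a)) (𝓝 a) (𝓝 0) := by
    have : Continuous fun z : ℝ => oddRoot d (z - a) :=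
      (continuous_oddRoot hd).comp (continuous_id.sub continuous_const)
    simpa [oddRoot_zero hd] using this.tendsto a
  filter_upwards [h2.eventually h1] with b hb
  rcases eq_or_ne b a with rfl | hba
  · exact hh0
  · have hroot : AnalyticAt ℝ (fun z : ℝ => oddRoot d (z - a)) b :=
      AnalyticAt.fun_comp (analyticAt_oddRoot (sub_ne_zero.2 hba)) (by fun_prop)
    have h3 := AnalyticAt.fun_comp (g := fun w => h (a + w ^ d))
      (f := fun z => oddRoot d (z - a)) hb hroot
    simp only [oddRoot_pow hd, add_sub_cancel] at h3
    exact h3.oddPuiseuxAt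

theorem eventuallyEq_of_isPreconnected {S : Set ℝ} (hS : IsPreconnected S)
    (hh : ∀ t ∈ S, OddPuiseuxAt h t) (hk : ∀ t ∈ S, OddPuiseuxAt k t) (ha : a ∈ S)
    (hhk : h =ᶠ[𝓝 a] k) {t : ℝ} (ht : t ∈ S) : h =ᶠ[𝓝 t] k := by
  refine hS.subset_of_closure_inter_subset (u := {t | h =ᶠ[𝓝 t] k})
    isOpen_setOfPred_eventually_nhds ⟨a, ha, hhk⟩ ?_ ht
  rintro s ⟨hs, hsS⟩
  by_contra hne
  refine hne ((hh s hsS).eventuallyEq_of_frequently (hk s hsS) ?_)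
  rw [frequently_nhdsWithin_iff]
  refine (mem_closure_iff_frequently.1 hs).mono fun r hr => ⟨hr.self_of_nhds, ?_⟩
  rintro rfl
  exact hne hr

end OddPuiseuxAt

/-! ### Functional dependence at regular points -/

theorem fderiv_plane_apply (f : Plane → ℝ) (x v : Plane) :
    fderiv ℝ f x v = v 0 * partialDeriv 0 f x + v 1 * partialDeriv 1 f x := by
  have hv : v = v 0 • EuclideanSpace.single 0 (1 : ℝ) + v 1 • EuclideanSpace.single 1 (1 : ℝ) := by
    ext i; fin_cases i <;> simp
  conv_lhs => rw [hv]
  simp [partialDeriv]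

theorem fderiv_apply_eq_zero_of_poissonBracket_eq_zero {f g : Plane → ℝ} {x v : Plane}
    (hf : fderiv ℝ f x ≠ 0) (hfg : poissonBracket f g x = 0) (hv : fderiv ℝ f x v = 0) :
    fderiv ℝ g x v = 0 := by
  rw [fderiv_plane_apply] at hv ⊢
  unfold poissonBracket at hfg
  by_cases h0 : partialDeriv 0 f x = 0
  · have h1 : partialDeriv 1 f x ≠ 0 := fun h1 => hf (by
      ext w; simp [fderiv_plane_apply, h0, h1])
    refine mul_left_cancel₀ h1 ?_
    linear_combination partialDeriv 1 g x * hv - v 0 * hfg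
  · refine mul_left_cancel₀ h0 ?_
    linear_combination partialDeriv 0 g x * hv + v 1 * hfg

/-- The linear form `v ↦ ∇^⊥ f (x) · v`. -/
noncomputable def perpForm (f : Plane → ℝ) (x : Plane) : Plane →L[ℝ] ℝ :=
  partialDeriv 0 f x • EuclideanSpace.proj (1 : Fin 2) -
    partialDeriv 1 f x • EuclideanSpace.proj (0 : Fin 2)

theorem injective_fderiv_prod_perpForm {f : Plane → ℝ} {x : Plane} (hf : fderiv ℝ f x ≠ 0) :
    Function.Injective ((fderiv ℝ f x).prod (perpForm f x)) := by
  rw [injective_iff_map_eq_zero]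
  intro v hv
  have h1 : v 0 * partialDeriv 0 f x + v 1 * partialDeriv 1 f x = 0 := by
    rw [← fderiv_plane_apply]; exact congrArg Prod.fst hv
  have h2 : partialDeriv 0 f x * v 1 - partialDeriv 1 f x * v 0 = 0 := by
    simpa [perpForm] using congrArg Prod.snd hv
  have hne : partialDeriv 0 f x ^ 2 + partialDeriv 1 f x ^ 2 ≠ 0 := fun h => hf (by
    have h0 : partialDeriv 0 f x = 0 := by nlinarith [sq_nonneg (partialDeriv 1 f x)]
    have h1 : partialDeriv 1 f x = 0 := by nlinarith [sq_nonneg (partialDeriv 0 f x)]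
    ext w; simp [fderiv_plane_apply, h0, h1])
  ext i
  fin_cases i
  · refine mul_left_cancel₀ hne ?_
    simp only [Fin.zero_eta, PiLp.zero_apply]
    linear_combination partialDeriv 0 f x * h1 - partialDeriv 1 f x * h2
  · refine mul_left_cancel₀ hne ?_
    simp only [Fin.mk_one, PiLp.zero_apply]
    linear_combination partialDeriv 1 f x * h1 + partialDeriv 0 f x * h2

/-- Near a point where `∇ f ≠ 0`, a function `g` with `{f, g} = 0` depends on the value of `f`
only. -/
theorem exists_nhds_eq_of_poissonBracket_eq_zero {f g : Plane → ℝ} {q : Plane}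
    (hf : AnalyticAt ℝ f q) (hg : AnalyticAt ℝ g q) (hq : fderiv ℝ f q ≠ 0)
    (hfg : ∀ᶠ x in 𝓝 q, poissonBracket f g x = 0) :
    ∃ U ∈ 𝓝 q, ∀ x ∈ U, ∀ y ∈ U, f x = f y → g x = g y := by
  -- Straighten `f` into the first coordinate of a local chart `Φ`; in this chart `g` has zero
  -- derivative in the second direction.
  let A : Plane ≃L[ℝ] ℝ × ℝ := (LinearMap.linearEquivOfInjective
    ((fderiv ℝ f q).prod (perpForm f q)).toLinearMap (injective_fderiv_prod_perpForm hq)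
    (by simp)).toContinuousLinearEquiv
  have hA : (A : Plane →L[ℝ] ℝ × ℝ) = (fderiv ℝ f q).prod (perpForm f q) := by
    ext v <;> rfl
  let Φ : Plane → ℝ × ℝ := fun x => (f x, perpForm f q x)
  have hΦ : HasStrictFDerivAt Φ (A : Plane →L[ℝ] ℝ × ℝ) q := by
    rw [hA]
    exact hf.hasStrictFDerivAt.prodMk (perpForm f q).hasStrictFDerivAt
  have hΦc : ContDiffAt ℝ 1 Φ q := hf.contDiffAt.prodMk (perpForm f q).contDiff.contDiffAt
  let Ψ := hΦ.localInverse Φ A q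
  have hΨc : ContDiffAt ℝ 1 Ψ (Φ q) := hΦc.to_localInverse hΦ.hasFDerivAt one_ne_zero
  have hΨq : Ψ (Φ q) = q := hΦ.localInverse_apply_image
  have hΨt : Tendsto Ψ (𝓝 (Φ q)) (𝓝 q) := by
    have := hΨc.continuousAt.tendsto
    rwa [hΨq] at this
  have hright : ∀ᶠ z in 𝓝 (Φ q), Φ (Ψ z) = z := hΦ.eventually_right_inverse
  have hleft : ∀ᶠ x in 𝓝 q, Ψ (Φ x) = x := hΦ.eventually_left_inverse
  have hf' : ∀ᶠ x in 𝓝 q, fderiv ℝ f x ≠ 0 :=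
    hf.fderiv.continuousAt.eventually_ne hq
  have hall : ∀ᶠ z in 𝓝 (Φ q), DifferentiableAt ℝ g (Ψ z) ∧ DifferentiableAt ℝ Ψ z ∧
      ∀ w : ℝ × ℝ, w.1 = 0 → fderiv ℝ g (Ψ z) (fderiv ℝ Ψ z w) = 0 := by
    filter_upwards [hright.eventually_nhds, hΨt.eventually hf', hΨt.eventually hfg,
      hΨt.eventually hf.eventually_analyticAt, hΨt.eventually hg.eventually_analyticAt,
      hΨc.eventually (by simp)] with z h1 h2 h3 h4 h5 h6
    have hd := h6.differentiableAt one_ne_zero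
    refine ⟨h5.differentiableAt, hd, fun w hw => ?_⟩
    refine fderiv_apply_eq_zero_of_poissonBracket_eq_zero h2 h3 ?_
    have hcomp : HasFDerivAt (fun z => f (Ψ z)) ((fderiv ℝ f (Ψ z)).comp (fderiv ℝ Ψ z)) z :=
      h4.differentiableAt.hasFDerivAt.comp z hd.hasFDerivAt
    have hfst : HasFDerivAt (fun z => f (Ψ z)) (ContinuousLinearMap.fst ℝ ℝ ℝ) z := by
      refine hasFDerivAt_fst.congr_of_eventuallyEq ?_
      filter_upwards [h1] with z' hz'
      exact congrArg Prod.fst hz'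
    have := congrArg (fun B : ℝ × ℝ →L[ℝ] ℝ => B w) (hcomp.unique hfst)
    simpa [hw] using this
  obtain ⟨ε, hε, hball⟩ := Metric.eventually_nhds_iff_ball.1 hall
  have hΦt : Tendsto Φ (𝓝 q) (𝓝 (Φ q)) := hΦc.continuousAt
  refine ⟨{x | Ψ (Φ x) = x ∧ Φ x ∈ Metric.ball (Φ q) ε},
    hleft.and (hΦt.eventually (Metric.ball_mem_nhds _ hε)), ?_⟩
  rintro x ⟨hx1, hx2⟩ y ⟨hy1, hy2⟩ hxy
  let ℓ : ℝ → ℝ × ℝ := AffineMap.lineMap (Φ x) (Φ y)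
  have hℓ : ∀ s ∈ Set.Icc (0 : ℝ) 1, ℓ s ∈ Metric.ball (Φ q) ε := fun s hs =>
    (convex_ball (Φ q) ε).lineMap_mem hx2 hy2 hs
  have hder : ∀ s ∈ Set.Icc (0 : ℝ) 1, HasDerivAt (fun s => g (Ψ (ℓ s))) 0 s := fun s hs => by
    obtain ⟨h1, h2, h3⟩ := hball _ (hℓ s hs)
    have h4 : HasDerivAt ℓ (Φ y - Φ x) s := AffineMap.hasDerivAt_lineMap
    have h5 := h1.hasFDerivAt.comp_hasDerivAt s (h2.hasFDerivAt.comp_hasDerivAt s h4)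
    rwa [h3 _ (by simp [Φ, hxy])] at h5
  have := constant_of_has_deriv_right_zero (f := fun s => g (Ψ (ℓ s)))
    (fun s hs => (hder s hs).continuousAt.continuousWithinAt)
    (fun s hs => (hder s (Set.Ico_subset_Icc_self hs)).hasDerivWithinAt) 1 (by simp)
  simpa [ℓ, hx1, hy1, eq_comm] using this

/-! ### Higher derivatives of analytic functions -/

section IteratedDerivatives

variable {E : Type*} [NormedAddCommGroup E] [NormedSpace ℝ E] {f : E → ℝ} {x : E}

theorem AnalyticAt.iteratedDeriv_comp_line (hf : AnalyticAt ℝ f x) (v : E) (k : ℕ) :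
    iteratedDeriv k (fun t : ℝ => f (x + t • v)) 0 = iteratedFDeriv ℝ k f x fun _ => v := by
  obtain ⟨p, r, hp⟩ := hf
  have h1 : HasFPowerSeriesAt (fun z => f (x + z)) p 0 := by
    simpa [add_comm] using hp.hasFPowerSeriesAt.comp_sub (-x)
  let L : ℝ →L[ℝ] E := ContinuousLinearMap.toSpanSingleton ℝ v
  have h2 : HasFPowerSeriesAt ((fun z => f (x + z)) ∘ L) (p.compContinuousLinearMap L) 0 :=
    HasFPowerSeriesAt.compContinuousLinearMap (by simpa using h1)
  obtain ⟨r', h3⟩ := h2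
  rw [iteratedDeriv_eq_iteratedFDeriv, ← hp.factorial_smul]
  refine (h3.factorial_smul (1 : ℝ) k).symm.trans ?_
  rw [FormalMultilinearSeries.compContinuousLinearMap_apply]
  simp [L, Function.comp_def]

/-- Polarization: `D^n f (x)` is the `n`-th derivative of the diagonal map `y ↦ p n (y, …, y)`,
which vanishes if all diagonal values do. -/
theorem AnalyticAt.exists_iteratedFDeriv_diag_ne_zero (hf : AnalyticAt ℝ f x) {n : ℕ}
    (hn : iteratedFDeriv ℝ n f x ≠ 0) : ∃ v, (iteratedFDeriv ℝ n f x fun _ => v) ≠ 0 := by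
  by_contra! H
  refine hn ?_
  obtain ⟨p, r, hp⟩ := hf
  have h0 : (fun y => p n fun _ => y) = fun _ => (0 : ℝ) := by
    ext y
    have := hp.factorial_smul y n
    rw [H, smul_eq_zero] at this
    exact this.resolve_left n.factorial_ne_zero
  ext v
  rw [hp.iteratedFDeriv_eq_sum_of_completeSpace,
    ← (p n).iteratedFDeriv_comp_diagonal x v, h0]
  have := congrFun (iteratedFDeriv_fun_zero (𝕜 := ℝ) (E := E) (F := ℝ) (n := n)) x
  rw [this]
  rfl

theorem AnalyticAt.eventually_eq_of_iteratedFDeriv_eq_zero (hf : AnalyticAt ℝ f x)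
    (h : ∀ k, 1 ≤ k → iteratedFDeriv ℝ k f x = 0) : ∀ᶠ y in 𝓝 x, f y = f x := by
  obtain ⟨p, r, hp⟩ := hf
  have hev : ∀ᶠ y in 𝓝 (0 : E), f (x + y) = f x := by
    filter_upwards [Metric.eball_mem_nhds (0 : E) hp.r_pos] with y hy
    refine (hp.hasSum_iteratedFDeriv hy).unique ?_
    convert hasSum_single (0 : ℕ) _ using 1
    · simp
    · intro n hn
      simp [h n (Nat.one_le_iff_ne_zero.2 hn)]
  have ht : Tendsto (fun y => y - x) (𝓝 x) (𝓝 0) := by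
    simpa using (continuous_sub_right x).tendsto x
  filter_upwards [ht.eventually hev] with y hy
  simpa using hy

end IteratedDerivatives

/-! ### Local factorization at points of odd degree -/

variable {f g : Plane → ℝ} {x : Plane}

theorem analyticOrderAt_line_eq_vanishingDegree (hf : AnalyticAt ℝ f x)
    (hd : vanishingDegree f x ≠ 0) : ∃ v : Plane,
      analyticOrderAt (fun t : ℝ => f (x + t • v) - f x) 0 = vanishingDegree f x := by
  have hne : {k : ℕ | 1 ≤ k ∧ iteratedFDeriv ℝ k f x ≠ 0}.Nonempty := by
    by_contra h
    rw [Set.not_nonempty_iff_eq_empty] at h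
    exact hd (by rw [vanishingDegree, h, Nat.sInf_empty])
  have hmem : 1 ≤ vanishingDegree f x ∧ iteratedFDeriv ℝ (vanishingDegree f x) f x ≠ 0 :=
    Nat.sInf_mem hne
  obtain ⟨v, hv⟩ := hf.exists_iteratedFDeriv_diag_ne_zero hmem.2
  have hfl : AnalyticAt ℝ (fun t : ℝ => f (x + t • v)) 0 :=
    AnalyticAt.fun_comp (g := f) (by simpa using hf) (by fun_prop)
  have hder : ∀ k, 1 ≤ k → iteratedDeriv k (fun t : ℝ => f (x + t • v) - f x) 0 =
      iteratedFDeriv ℝ k f x fun _ => v := fun k hk => by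
    rw [iteratedDeriv_fun_sub hfl.contDiffAt contDiffAt_const, hf.iteratedDeriv_comp_line,
      iteratedDeriv_const, if_neg (by lia), sub_zero]
  refine ⟨v, (analyticOrderAt_eq_nat_iff_iteratedDeriv_eq_zero
    (hfl.fun_sub analyticAt_const)).2 ⟨fun k hk => ?_, ?_⟩⟩
  · rcases Nat.eq_zero_or_pos k with rfl | hk0
    · simp
    · rw [hder k hk0]
      have : iteratedFDeriv ℝ k f x = 0 := by
        by_contra h
        exact Nat.notMem_of_lt_sInf hk ⟨hk0, h⟩
      simp [this]
  · rwa [hder _ hmem.1]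

/-- At a point of odd degree `d` there is an analytic curve along which `f` varies like `s ^ d`. -/
theorem exists_analytic_curve (hf : AnalyticAt ℝ f x) (hd : Odd (vanishingDegree f x)) :
    ∃ c : ℝ → Plane, AnalyticAt ℝ c 0 ∧ c 0 = x ∧
      ∀ᶠ s in 𝓝 0, f (c s) = f x + s ^ vanishingDegree f x := by
  obtain ⟨v, hv⟩ := analyticOrderAt_line_eq_vanishingDegree hf hd.pos.ne'
  set d := vanishingDegree f x
  have hfl : AnalyticAt ℝ (fun t : ℝ => f (x + t • v)) 0 :=
    AnalyticAt.fun_comp (g := f) (by simpa using hf) (by fun_prop)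
  obtain ⟨u, hu, hu0, hfu⟩ := (hfl.fun_sub analyticAt_const).analyticOrderAt_eq_natCast.1 hv
  -- `σ ^ d` is the increment of `f` along the line, and `σ` has nonzero derivative at `0`; its
  -- inverse `T` is the reparametrization.
  let σ : ℝ → ℝ := fun t => t * oddRoot d (u t)
  have hroot : AnalyticAt ℝ (fun t => oddRoot d (u t)) 0 :=
    AnalyticAt.fun_comp (g := oddRoot d) (analyticAt_oddRoot hu0) hu
  have hσ : AnalyticAt ℝ σ 0 := analyticAt_id.mul hroot
  have hσ' : deriv σ 0 ≠ 0 := by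
    have := (hasDerivAt_id' (0 : ℝ)).fun_mul hroot.differentiableAt.hasDerivAt
    have h2 : HasDerivAt σ (oddRoot d (u 0)) 0 := by simpa using this
    rw [h2.deriv]
    exact oddRoot_ne_zero hd hu0
  have hs := hσ.hasStrictDerivAt
  let T := hs.localInverse σ (deriv σ 0) 0 hσ'
  have hσ0 : σ 0 = 0 := by simp [σ]
  have hT : AnalyticAt ℝ T 0 := by
    have := hσ.analyticAt_localInverse hσ'
    rwa [hσ0] at this
  have hT0 : T 0 = 0 := by
    have := (hs.eventually_left_inverse hσ').self_of_nhds
    rwa [hσ0] at this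
  have hright : ∀ᶠ s in 𝓝 0, σ (T s) = s := by
    have := (hs.hasStrictFDerivAt_equiv hσ').eventually_right_inverse
    rwa [hσ0] at this
  have hTt : Tendsto T (𝓝 0) (𝓝 0) := by
    simpa [ContinuousAt, hT0] using hT.continuousAt
  refine ⟨fun s => x + T s • v, by fun_prop, by simp [hT0], ?_⟩
  filter_upwards [hright, hTt.eventually hfu] with s h1 h2
  rw [← sub_eq_iff_eq_add', h2, sub_zero, smul_eq_mul]
  conv_rhs => rw [← h1]
  simp only [σ, mul_pow, oddRoot_pow hd]

theorem nhds_le_map_of_odd (hf : AnalyticAt ℝ f x) (hd : Odd (vanishingDegree f x)) :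
    𝓝 (f x) ≤ map f (𝓝 x) := by
  obtain ⟨c, hc, hc0, hfc⟩ := exists_analytic_curve hf hd
  rw [← map_pow_nhds_zero hd (f x), ← map_congr hfc]
  have : Tendsto c (𝓝 0) (𝓝 x) := by simpa [ContinuousAt, hc0] using hc.continuousAt
  exact (map_map (f := 𝓝 0) (m := c) (m' := f)).ge.trans (map_mono this)

/-- Near a point of odd degree, `{f, g} = 0` forces `g` to be an odd Puiseux function of `f`. -/
theorem exists_local_factorization (hf : AnalyticAt ℝ f x) (hg : AnalyticAt ℝ g x)
    (hfg : ∀ᶠ y in 𝓝 x, poissonBracket f g y = 0) (hd : Odd (vanishingDegree f x)) :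
    ∃ F : ℝ → ℝ, OddPuiseuxAt F (f x) ∧ ∀ᶠ y in 𝓝 x, g y = F (f y) := by
  obtain ⟨c, hc, hc0, hfc⟩ := exists_analytic_curve hf hd
  set d := vanishingDegree f x
  let F : ℝ → ℝ := fun τ => g (c (oddRoot d (τ - f x)))
  have hF : OddPuiseuxAt F (f x) := by
    refine ⟨d, hd, ?_⟩
    have : AnalyticAt ℝ (fun w => g (c w)) 0 :=
      AnalyticAt.fun_comp (g := g) (by rwa [hc0]) hc
    simpa [F, oddRoot_pow_self hd] using this
  refine ⟨F, hF, ?_⟩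
  have hgood : ∀ᶠ y in 𝓝 x, AnalyticAt ℝ f y ∧ AnalyticAt ℝ g y ∧ OddPuiseuxAt F (f y) ∧
      poissonBracket f g y = 0 :=
    hf.eventually_analyticAt.and (hg.eventually_analyticAt.and
      ((hf.continuousAt.eventually hF.eventually).and hfg))
  obtain ⟨ε, hε, hball⟩ := Metric.eventually_nhds_iff_ball.1 hgood
  have hct : Tendsto c (𝓝 0) (𝓝 x) := by simpa [ContinuousAt, hc0] using hc.continuousAt
  -- The base point `c s` is off the center: there `f ∘ c` has derivative `d * s ^ (d - 1) ≠ 0`, so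
  -- `f` is regular.
  obtain ⟨s, ⟨hs1, hs2, hs3⟩, hs0⟩ : ∃ s : ℝ, (c s ∈ Metric.ball x ε ∧ AnalyticAt ℝ c s ∧
      ∀ᶠ s' in 𝓝 s, f (c s') = f x + s' ^ d) ∧ s ≠ 0 := by
    have h1 : ∀ᶠ s in 𝓝 (0 : ℝ), c s ∈ Metric.ball x ε ∧ AnalyticAt ℝ c s ∧
        ∀ᶠ s' in 𝓝 s, f (c s') = f x + s' ^ d :=
      (hct.eventually (Metric.ball_mem_nhds x hε)).and
        (hc.eventually_analyticAt.and hfc.eventually_nhds)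
    exact ((h1.filter_mono nhdsWithin_le_nhds).and
      (eventually_mem_nhdsWithin (a := (0 : ℝ)) (s := {0}ᶜ))).exists
  obtain ⟨hfq, hgq, -, -⟩ := hball _ hs1
  have hq : fderiv ℝ f (c s) ≠ 0 := by
    intro h0
    have h1 : HasDerivAt (fun s => f (c s)) (fderiv ℝ f (c s) (deriv c s)) s :=
      hfq.differentiableAt.hasFDerivAt.comp_hasDerivAt s hs2.differentiableAt.hasDerivAt
    have h2 : HasDerivAt (fun s => f (c s)) (d * s ^ (d - 1)) s :=
      ((hasDerivAt_pow d s).const_add (f x)).congr_of_eventuallyEq hs3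
    have h3 := h1.unique h2
    rw [h0] at h3
    exact mul_ne_zero (Nat.cast_ne_zero.2 hd.pos.ne') (pow_ne_zero _ hs0) h3.symm
  obtain ⟨U, hU, hUfg⟩ := exists_nhds_eq_of_poissonBracket_eq_zero hfq hgq hq
    (by filter_upwards [Metric.isOpen_ball.mem_nhds hs1] with y hy using (hball y hy).2.2.2)
  have hbase : ∀ᶠ y in 𝓝 (c s), g y = F (f y) := by
    have hfs : f (c s) = f x + s ^ d := hs3.self_of_nhds
    have h1 : Tendsto (fun y => oddRoot d (f y - f x)) (𝓝 (c s)) (𝓝 s) := by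
      have h2 : ContinuousAt (fun y => oddRoot d (f y - f x)) (c s) :=
        (continuous_oddRoot hd).continuousAt.comp (hfq.continuousAt.sub continuousAt_const)
      simpa [ContinuousAt, hfs, oddRoot_pow_self hd] using h2
    filter_upwards [hU, h1.eventually hs3, h1.eventually (hs2.continuousAt hU)] with y h2 h3 h4
    exact hUfg y h2 _ h4 (by rw [h3, oddRoot_pow hd, add_sub_cancel])
  filter_upwards [Metric.ball_mem_nhds x hε] with y hy
  let ℓ : ℝ → Plane := AffineMap.lineMap (c s) y
  have hℓ : ∀ t ∈ Set.Icc (0 : ℝ) 1, ℓ t ∈ Metric.ball x ε := fun t ht =>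
    (convex_ball x ε).lineMap_mem hs1 hy ht
  have hℓa : ∀ t, AnalyticAt ℝ ℓ t := fun t => by
    have : ℓ = fun t => t • (y - c s) + c s := by
      ext1 t; simp [ℓ, AffineMap.lineMap_apply]
    rw [this]
    fun_prop
  have hℓ0 : ℓ 0 = c s := by simp [ℓ]
  have := OddPuiseuxAt.eventuallyEq_of_isPreconnected (h := fun t => g (ℓ t))
    (k := fun t => F (f (ℓ t))) (S := Set.Icc 0 1) (a := 0) (t := 1) isPreconnected_Icc
    (fun t ht => (AnalyticAt.fun_comp (g := g) (hball _ (hℓ t ht)).2.1 (hℓa t)).oddPuiseuxAt)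
    (fun t ht => OddPuiseuxAt.comp_analyticAt (φ := fun t => f (ℓ t)) (hball _ (hℓ t ht)).2.2.1
      (AnalyticAt.fun_comp (g := f) (hball _ (hℓ t ht)).1 (hℓa t)))
    (by simp) ?_ (by simp)
  · simpa [ℓ] using this.self_of_nhds
  · have hℓt : Tendsto ℓ (𝓝 0) (𝓝 (c s)) := by
      simpa [ContinuousAt, hℓ0] using (hℓa 0).continuousAt
    exact hℓt.eventually hbase

/-! ### Removing a countable set -/

theorem IsPreconnected.diff_countable {E : Type*} [NormedAddCommGroup E] [NormedSpace ℝ E]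
    (hE : 1 < Module.rank ℝ E) {Ω C : Set E} (hΩ : IsOpen Ω) (hΩc : IsPreconnected Ω)
    (hC : C.Countable) : IsPreconnected (Ω \ C) := by
  have : Nontrivial E := rank_pos_iff_nontrivial (R := ℝ).1 (zero_lt_one.trans hE)
  have hball : ∀ (p : E) (ε : ℝ), 0 < ε → IsPreconnected (Metric.ball p ε \ C) := by
    intro p ε hε
    let e := OpenPartialHomeomorph.univBall p ε
    have he : Function.Injective e := by
      simpa [e, Set.injOn_univ] using e.injOn
    have hrange : e '' Set.univ = Metric.ball p ε := by
      have := e.image_source_eq_target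
      rwa [OpenPartialHomeomorph.univBall_source,
        OpenPartialHomeomorph.univBall_target p hε] at this
    have himage : e '' (e ⁻¹' C)ᶜ = Metric.ball p ε \ C := by
      rw [← hrange, Set.compl_eq_univ_sdiff, Set.image_sdiff he, Set.image_preimage_eq_inter_range,
        Set.image_univ]
      ext z
      simp only [Set.mem_sdiff, Set.mem_inter_iff]
      tauto
    rw [← himage]
    exact ((hC.preimage he).isConnected_compl_of_one_lt_rank hE).isPreconnected.image _
      (OpenPartialHomeomorph.continuous_univBall p ε).continuousOn
  intro u v hu hv huv ⟨x, hx, hxu⟩ ⟨y, hy, hyv⟩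
  by_contra hne
  -- A separation of `Ω \ C` cannot split a punctured ball, so each point of `Ω` has a neighborhood
  -- lying in one side up to `C`; this would separate `Ω`.
  have hcover : Ω ⊆ {p | ∀ᶠ z in 𝓝 p, z ∉ C → z ∈ u} ∪ {p | ∀ᶠ z in 𝓝 p, z ∉ C → z ∈ v} := by
    intro p hp
    obtain ⟨ε, hε, hεΩ⟩ := Metric.isOpen_iff.1 hΩ p hp
    have hsub : Metric.ball p ε \ C ⊆ Ω \ C := Set.sdiff_subset_sdiff_left hεΩ
    by_contra hcon
    simp only [Set.mem_union, Set.mem_ofPred_eq, not_or] at hcon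
    have key : ∀ w : Set E, ¬ (∀ᶠ z in 𝓝 p, z ∉ C → z ∈ w) →
        ∃ z ∈ Metric.ball p ε \ C, z ∉ w := by
      intro w hw
      by_contra! h
      exact hw (mem_of_superset (Metric.ball_mem_nhds p hε) fun z hz hzC => h z ⟨hz, hzC⟩)
    obtain ⟨a, ha, hau⟩ := key u hcon.1
    obtain ⟨b, hb, hbv⟩ := key v hcon.2
    obtain ⟨z, hz, hzuv⟩ := hball p ε hε u v hu hv (hsub.trans huv)
      ⟨b, hb, (huv (hsub hb)).resolve_right hbv⟩ ⟨a, ha, (huv (hsub ha)).resolve_left hau⟩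
    exact hne ⟨z, hsub hz, hzuv⟩
  obtain ⟨p, hpΩ, hpu, hpv⟩ := hΩc _ _ isOpen_setOfPred_eventually_nhds
    isOpen_setOfPred_eventually_nhds hcover
    ⟨x, hx.1, mem_of_superset (hu.mem_nhds hxu) fun z hz _ => hz⟩
    ⟨y, hy.1, mem_of_superset (hv.mem_nhds hyv) fun z hz _ => hz⟩
  obtain ⟨z, hzC, ⟨hzu, hzv⟩, hzΩ⟩ := (mem_closure_iff_frequently.1 (hC.dense_compl ℝ p)).and_eventually
    ((Filter.Eventually.and hpu hpv).and (hΩ.mem_nhds hpΩ)) |>.exists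
  exact hne ⟨z, ⟨hzΩ, hzC⟩, hzu hzC, hzv hzC⟩

theorem countable_of_eventually_notMem {α : Type*} [TopologicalSpace α]
    [SecondCountableTopology α] {S : Set α} (hS : ∀ x ∈ S, ∀ᶠ y in 𝓝[≠] x, y ∉ S) :
    S.Countable := by
  have : DiscreteTopology S := discreteTopology_subtype_iff.2 fun x hx => by
    rw [← disjoint_iff, disjoint_principal_right]
    exact hS x hx
  exact Set.countable_coe_iff.1 (TopologicalSpace.separableSpace_iff_countable.1 inferInstance)

/-! ### Continuation of local factors and extension to the endpoints -/

section Gluing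

variable {α : Type*} [TopologicalSpace α] {X : Set α} {f g : α → ℝ}

theorem eventuallyEq_of_comp_eventuallyEq {F G : ℝ → ℝ} {x : α} (hopen : 𝓝 (f x) ≤ map f (𝓝 x))
    (hF : ∀ᶠ y in 𝓝 x, g y = F (f y)) (hG : ∀ᶠ y in 𝓝 x, g y = G (f y)) : F =ᶠ[𝓝 (f x)] G :=
  hopen (mem_map.2 (by filter_upwards [hF, hG] with y h1 h2 using h1.symm.trans h2))

theorem OddPuiseuxAt.eqOn_inter {F G : ℝ → ℝ} {J K : Set ℝ} {a : ℝ} (hJ : IsPreconnected J)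
    (hK : IsPreconnected K) (hF : ∀ τ ∈ J, OddPuiseuxAt F τ) (hG : ∀ τ ∈ K, OddPuiseuxAt G τ)
    (haJ : a ∈ J) (haK : a ∈ K) (hFG : F =ᶠ[𝓝 a] G) : Set.EqOn F G (J ∩ K) := fun τ hτ => by
  have hJK : IsPreconnected (J ∩ K) :=
    isPreconnected_iff_ordConnected.2 (hJ.ordConnected.inter hK.ordConnected)
  exact (OddPuiseuxAt.eventuallyEq_of_isPreconnected hJK (fun t ht => hF t ht.1)
    (fun t ht => hG t ht.2) ⟨haJ, haK⟩ hFG hτ).self_of_nhds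

theorem OddPuiseuxAt.exists_glue {F G : ℝ → ℝ} {J K : Set ℝ} (hJo : IsOpen J) (hKo : IsOpen K)
    (hF : ∀ τ ∈ J, OddPuiseuxAt F τ) (hG : ∀ τ ∈ K, OddPuiseuxAt G τ)
    (hFG : Set.EqOn F G (J ∩ K)) :
    ∃ H : ℝ → ℝ, Set.EqOn H F J ∧ Set.EqOn H G K ∧ ∀ τ ∈ J ∪ K, OddPuiseuxAt H τ := by
  classical
  have h1 : Set.EqOn (J.piecewise F G) F J := Set.piecewise_eqOn _ _ _
  have h2 : Set.EqOn (J.piecewise F G) G K := fun τ hτ => by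
    by_cases hJ : τ ∈ J
    · rw [Set.piecewise_eq_of_mem _ _ _ hJ, hFG ⟨hJ, hτ⟩]
    · rw [Set.piecewise_eq_of_notMem _ _ _ hJ]
  refine ⟨_, h1, h2, ?_⟩
  rintro τ (hτ | hτ)
  · exact (hF τ hτ).congr (h1.symm.eventuallyEq_of_mem (hJo.mem_nhds hτ))
  · exact (hG τ hτ).congr (h2.symm.eventuallyEq_of_mem (hKo.mem_nhds hτ))

/-- A local factorization through odd Puiseux functions at `x₀` continues to every point of a
preconnected set: the continuation takes place on intervals of `ℝ`. -/
theorem exists_factorization_to (hX : IsPreconnected X) (hf : ∀ x ∈ X, ContinuousAt f x)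
    (hopen : ∀ x ∈ X, 𝓝 (f x) ≤ map f (𝓝 x))
    (hloc : ∀ x ∈ X, ∃ F, OddPuiseuxAt F (f x) ∧ ∀ᶠ y in 𝓝 x, g y = F (f y))
    {x₀ y : α} (hx₀ : x₀ ∈ X) (hy : y ∈ X) :
    ∃ (J : Set ℝ) (F : ℝ → ℝ), (IsOpen J ∧ IsPreconnected J ∧ f x₀ ∈ J ∧
      (∀ τ ∈ J, OddPuiseuxAt F τ) ∧ ∀ᶠ z in 𝓝 x₀, g z = F (f z)) ∧
      ∀ᶠ z in 𝓝 y, f z ∈ J ∧ g z = F (f z) := by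
  have hloc' : ∀ x ∈ X, ∃ (K : Set ℝ) (G : ℝ → ℝ), IsOpen K ∧ IsPreconnected K ∧ f x ∈ K ∧
      (∀ τ ∈ K, OddPuiseuxAt G τ) ∧ ∀ᶠ z in 𝓝 x, f z ∈ K ∧ g z = G (f z) := by
    intro x hx
    obtain ⟨G, hG, hgG⟩ := hloc x hx
    obtain ⟨ε, hε, hball⟩ := Metric.eventually_nhds_iff_ball.1 hG.eventually
    exact ⟨Metric.ball (f x) ε, G, Metric.isOpen_ball, (convex_ball _ _).isPreconnected,
      Metric.mem_ball_self hε, hball, ((hf x hx).eventually (Metric.ball_mem_nhds _ hε)).and hgG⟩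
  set u : Set α := {y | ∃ (J : Set ℝ) (F : ℝ → ℝ), (IsOpen J ∧ IsPreconnected J ∧ f x₀ ∈ J ∧
      (∀ τ ∈ J, OddPuiseuxAt F τ) ∧ ∀ᶠ z in 𝓝 x₀, g z = F (f z)) ∧
      ∀ᶠ z in 𝓝 y, f z ∈ J ∧ g z = F (f z)} with hu
  have huo : IsOpen u := by
    rw [isOpen_iff_mem_nhds]
    rintro z ⟨J, F, h1, h2⟩
    filter_upwards [h2.eventually_nhds] with w hw using ⟨J, F, h1, hw⟩
  have hx₀u : x₀ ∈ u := by
    obtain ⟨K, G, h1, h2, h3, h4, h5⟩ := hloc' x₀ hx₀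
    exact ⟨K, G, ⟨h1, h2, h3, h4, h5.mono fun z hz => hz.2⟩, h5⟩
  have hclosed : ∀ z ∈ X, (∃ᶠ w in 𝓝 z, w ∈ X ∧ w ∈ u) → z ∈ u := by
    intro z hz hfr
    obtain ⟨K, G, hKo, hK, -, hG, hgG⟩ := hloc' z hz
    obtain ⟨w, ⟨hwX, J, F, ⟨hJo, hJ, hx₀J, hF, hgF₀⟩, hgF⟩, hgGw⟩ :=
      (hfr.and_eventually hgG.eventually_nhds).exists
    have hFG : Set.EqOn F G (J ∩ K) :=
      OddPuiseuxAt.eqOn_inter hJ hK hF hG hgF.self_of_nhds.1 hgGw.self_of_nhds.1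
        (eventuallyEq_of_comp_eventuallyEq (hopen w hwX) (hgF.mono fun _ h => h.2)
          (hgGw.mono fun _ h => h.2))
    obtain ⟨H, hHF, hHG, hH⟩ := OddPuiseuxAt.exists_glue hJo hKo hF hG hFG
    refine ⟨J ∪ K, H, ⟨hJo.union hKo,
      hJ.union (f w) hgF.self_of_nhds.1 hgGw.self_of_nhds.1 hK, Or.inl hx₀J, hH, ?_⟩, ?_⟩
    · filter_upwards [hgF₀, (hf x₀ hx₀).eventually (hJo.mem_nhds hx₀J)] with a h1 h2
      rw [h1, hHF h2]
    · filter_upwards [hgG] with a ha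
      exact ⟨Or.inr ha.1, by rw [ha.2, hHG ha.1]⟩
  change y ∈ u
  by_contra hyu
  obtain ⟨z, hzX, hzu, hzv⟩ := hX u {z | ∀ᶠ w in 𝓝 z, w ∈ X → w ∉ u} huo
    isOpen_setOfPred_eventually_nhds
    (fun z hz => by
      by_contra hcon
      simp only [Set.mem_union, Set.mem_ofPred_eq, not_or] at hcon
      exact hcon.1 (hclosed z hz ((not_eventually.1 hcon.2).mono fun w hw => by tauto)))
    ⟨x₀, hx₀, hx₀u⟩
    ⟨y, hy, by
      by_contra hcon
      exact hyu (hclosed y hy ((not_eventually.1 hcon).mono fun w hw => by tauto))⟩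
  exact (Filter.Eventually.self_of_nhds hzv) hzX hzu

theorem exists_factorization_on (hX : IsPreconnected X) (hne : X.Nonempty)
    (hf : ∀ x ∈ X, ContinuousAt f x) (hopen : ∀ x ∈ X, 𝓝 (f x) ≤ map f (𝓝 x))
    (hloc : ∀ x ∈ X, ∃ F, OddPuiseuxAt F (f x) ∧ ∀ᶠ y in 𝓝 x, g y = F (f y)) :
    ∃ (J : Set ℝ) (F : ℝ → ℝ), IsOpen J ∧ IsPreconnected J ∧ ContinuousOn F J ∧
      ∀ x ∈ X, f x ∈ J ∧ g x = F (f x) := by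
  obtain ⟨x₀, hx₀⟩ := hne
  choose! J F h1 h2 using fun y (hy : y ∈ X) => exists_factorization_to hX hf hopen hloc hx₀ hy
  -- All continuations start from the same germ at `f x₀`, so they agree on overlaps.
  have hcompat : ∀ y ∈ X, ∀ z ∈ X, Set.EqOn (F y) (F z) (J y ∩ J z) := by
    intro y hy z hz
    obtain ⟨-, a2, a3, a4, a5⟩ := h1 y hy
    obtain ⟨-, b2, b3, b4, b5⟩ := h1 z hz
    exact OddPuiseuxAt.eqOn_inter a2 b2 a4 b4 a3 b3
      (eventuallyEq_of_comp_eventuallyEq (hopen x₀ hx₀) a5 b5)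
  classical
  let G : ℝ → ℝ := fun τ => if h : ∃ y ∈ X, τ ∈ J y then F h.choose τ else 0
  have hG : ∀ y ∈ X, Set.EqOn G (F y) (J y) := by
    intro y hy τ hτ
    have h : ∃ y ∈ X, τ ∈ J y := ⟨y, hy, hτ⟩
    simp only [G, dif_pos h]
    exact hcompat _ h.choose_spec.1 _ hy ⟨h.choose_spec.2, hτ⟩
  refine ⟨⋃ y ∈ X, J y, G, isOpen_biUnion fun y hy => (h1 y hy).1, ?_, ?_, fun x hx => ?_⟩
  · rw [Set.biUnion_eq_iUnion]
    exact isPreconnected_iUnion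
      ⟨f x₀, Set.mem_iInter.2 fun y : X => (h1 y y.2).2.2.1⟩ fun y : X => (h1 y y.2).2.1
  · intro τ hτ
    obtain ⟨y, hy, hτy⟩ := Set.mem_iUnion₂.1 hτ
    exact (((h1 y hy).2.2.2.1 τ hτy).continuousAt.congr ((hG y hy).symm.eventuallyEq_of_mem
      ((h1 y hy).1.mem_nhds hτy))).continuousWithinAt
  · obtain ⟨h3, h4⟩ := (h2 x hx).self_of_nhds
    exact ⟨Set.mem_biUnion hx h3, by rw [h4, hG x hx h3]⟩

/-- A factorization on a dense subset of an open set in a locally connected space extends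
continuously to the whole open set. -/
theorem exists_continuousOn_factorization [LocallyConnectedSpace α] {Ω : Set α} (hΩ : IsOpen Ω)
    (hf : ContinuousOn f Ω) (hg : ContinuousOn g Ω)
    (hdense : ∀ p ∈ Ω, ∃ᶠ y in 𝓝 p, y ∈ X) {J : Set ℝ} {F : ℝ → ℝ} (hJo : IsOpen J)
    (hJ : IsPreconnected J) (hF : ContinuousOn F J) (hX : ∀ x ∈ X, f x ∈ J ∧ g x = F (f x)) :
    ∃ F' : ℝ → ℝ, ContinuousOn F' (f '' Ω) ∧ ∀ x ∈ Ω, g x = F' (f x) := by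
  have hfp : ∀ p ∈ Ω, ContinuousAt f p := fun p hp => hf.continuousAt (hΩ.mem_nhds hp)
  have hgp : ∀ p ∈ Ω, ContinuousAt g p := fun p hp => hg.continuousAt (hΩ.mem_nhds hp)
  have hFJ : ∀ τ ∈ J, ContinuousAt F τ := fun τ hτ => hF.continuousAt (hJo.mem_nhds hτ)
  have heq : ∀ p ∈ Ω, f p ∈ J → g p = F (f p) := by
    intro p hp hpJ
    by_contra hne
    have hev : ∀ᶠ y in 𝓝 p, g y ≠ F (f y) :=
      ((hgp p hp).tendsto.prodMk_nhds ((hFJ _ hpJ).comp (f := f) (hfp p hp)).tendsto).eventually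
        (isOpen_ne_fun continuous_fst continuous_snd |>.mem_nhds hne)
    obtain ⟨y, hy, hy'⟩ := ((hdense p hp).and_eventually hev).exists
    exact hy' (hX y hy).2
  have hcl : ∀ p ∈ Ω, f p ∈ closure J := fun p hp =>
    mem_closure_of_frequently_of_tendsto ((hdense p hp).mono fun y hy => (hX y hy).1) (hfp p hp)
  have htend : ∀ p ∈ Ω, Tendsto F (𝓝[J] (f p)) (𝓝 (g p)) := by
    intro p hp
    by_cases hpJ : f p ∈ J
    · rw [heq p hp hpJ]
      exact (hFJ _ hpJ).tendsto.mono_left nhdsWithin_le_nhds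
    · intro W hW
      -- The image of a small connected `B` around `p` fills the interval from `f p` to `f y`, so
      -- near `f p` the values of `F` on `J` are values of `g` on `B`.
      obtain ⟨B, hB, hBo, hpB, hBc⟩ := locallyConnectedSpace_iff_subsets_isOpen_isConnected.1
        inferInstance p (Ω ∩ g ⁻¹' W) (inter_mem (hΩ.mem_nhds hp) (hgp p hp hW))
      obtain ⟨y, hyX, hyB⟩ := ((hdense p hp).and_eventually (hBo.mem_nhds hpB)).exists
      have hyJ := (hX y hyX).1
      have himg : Set.uIcc (f p) (f y) ⊆ f '' B :=
        (hBc.isPreconnected.image f (hf.mono fun z hz => (hB hz).1)).ordConnected.uIcc_subset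
          ⟨p, hpB, rfl⟩ ⟨y, hyB, rfl⟩
      have hev : ∀ᶠ τ in 𝓝[J] (f p), τ ∈ Set.uIcc (f p) (f y) := by
        -- The interval `J` misses `f p`, hence lies entirely on the side of `f y`.
        have hne : f p ≠ f y := fun h => hpJ (h ▸ hyJ)
        rcases lt_or_gt_of_ne hne with hlt | hlt
        · filter_upwards [self_mem_nhdsWithin,
            (eventually_lt_nhds hlt).filter_mono nhdsWithin_le_nhds] with τ h1 h2
          rw [Set.uIcc_of_le hlt.le]
          refine ⟨?_, h2.le⟩
          by_contra! h3
          exact hpJ (hJ.ordConnected.out h1 hyJ ⟨h3.le, hlt.le⟩)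
        · filter_upwards [self_mem_nhdsWithin,
            (eventually_gt_nhds hlt).filter_mono nhdsWithin_le_nhds] with τ h1 h2
          rw [Set.uIcc_of_ge hlt.le]
          refine ⟨h2.le, ?_⟩
          by_contra! h3
          exact hpJ (hJ.ordConnected.out hyJ h1 ⟨hlt.le, h3.le⟩)
      rw [mem_map]
      filter_upwards [hev, self_mem_nhdsWithin] with τ h1 h2
      obtain ⟨z, hzB, rfl⟩ := himg h1
      rw [Set.mem_preimage, ← heq z (hB hzB).1 h2]
      exact (hB hzB).2
  refine ⟨extendFrom J F, continuousOn_extendFrom ?_ ?_, fun x hx => ?_⟩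
  · rintro _ ⟨p, hp, rfl⟩
    exact hcl p hp
  · rintro _ ⟨p, hp, rfl⟩
    exact ⟨g p, htend p hp⟩
  · exact (extendFrom_eq (hcl x hx) (htend x hx)).symm

end Gluing

/-! ### Conclusion -/

theorem vanishingDegree_ne_zero {f : Plane → ℝ} {Ω : Set Plane} (hΩ : IsPreconnected Ω)
    (hf : AnalyticOnNhd ℝ f Ω) (hne : ∃ x ∈ Ω, ∃ y ∈ Ω, f x ≠ f y) {x : Plane} (hx : x ∈ Ω) :
    vanishingDegree f x ≠ 0 := by
  intro h0
  have hconst : ∀ᶠ y in 𝓝 x, f y = f x := by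
    refine (hf x hx).eventually_eq_of_iteratedFDeriv_eq_zero fun k hk => ?_
    rcases Nat.sInf_eq_zero.1 h0 with h | h
    · exact absurd h.1 (by simp)
    · by_contra hk'
      have : k ∈ (∅ : Set ℕ) := h ▸ ⟨hk, hk'⟩
      exact this
  have heq := hf.eqOn_of_preconnected_of_eventuallyEq analyticOnNhd_const hΩ hx hconst
  obtain ⟨a, ha, b, hb, hab⟩ := hne
  exact hab ((heq ha).trans (heq hb).symm)

theorem lemma1p2 (Ω : Set Plane) (hΩ_open : IsOpen Ω) (hΩ_conn : IsConnected Ω)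
    (f g : Plane → ℝ) (hf : AnalyticOnNhd ℝ f Ω) (hg : AnalyticOnNhd ℝ g Ω)
    (hf_nonconst : ∃ x ∈ Ω, ∃ y ∈ Ω, f x ≠ f y)
    (hbracket : ∀ x ∈ Ω, poissonBracket f g x = 0)
    (hisolated : ∀ x ∈ evenCriticalPoints Ω f, ∀ᶠ y in 𝓝[≠] x, y ∉ evenCriticalPoints Ω f) :
    ∃ F : ℝ → ℝ, ContinuousOn F (f '' Ω) ∧ ∀ x ∈ Ω, g x = F (f x) := by
  have hC := countable_of_eventually_notMem hisolated
  have hrank : 1 < Module.rank ℝ Plane := by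
    rw [← Module.finrank_eq_rank]
    simp
  have hX := hΩ_conn.isPreconnected.diff_countable hrank hΩ_open hC
  have hdense : ∀ p ∈ Ω, ∃ᶠ y in 𝓝 p, y ∈ Ω \ evenCriticalPoints Ω f := fun p hp =>
    ((mem_closure_iff_frequently.1 (hC.dense_compl ℝ p)).and_eventually (hΩ_open.mem_nhds hp)).mono
      fun _ h => ⟨h.2, h.1⟩
  have hodd : ∀ x ∈ Ω \ evenCriticalPoints Ω f, Odd (vanishingDegree f x) := by
    rintro x ⟨hx, hxC⟩
    have h0 := vanishingDegree_ne_zero hΩ_conn.isPreconnected hf hf_nonconst hx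
    by_contra h
    rw [Nat.not_odd_iff_even] at h
    refine hxC ⟨hx, ?_, h⟩
    obtain ⟨m, hm⟩ := h
    lia
  obtain ⟨p, hp⟩ := hΩ_conn.nonempty
  obtain ⟨J, F, hJo, hJ, hF, hfac⟩ := exists_factorization_on (f := f) (g := g) hX
    (hdense p hp).exists (fun x hx => (hf x hx.1).continuousAt)
    (fun x hx => nhds_le_map_of_odd (hf x hx.1) (hodd x hx))
    (fun x hx => exists_local_factorization (hf x hx.1) (hg x hx.1)
      (by filter_upwards [hΩ_open.mem_nhds hx.1] with y hy using hbracket y hy) (hodd x hx))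
  exact exists_continuousOn_factorization hΩ_open hf.continuousOn hg.continuousOn hdense hJo hJ hF
    hfac
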